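/- A buyer in a first-price auction has a value $v\in[0,1]$ distributed according to $F\in\Delta([0,1])$, and a bidding strategy is a Markov kernel $s$ mapping each value $v$ to a bid distribution $s(v)\in\Delta([0,1])$; let $\mathcal S$ be the set of all bidding strategies. Against an independent highest competing bid $h\sim H\in\Delta([0,1])$ the expected utility is $U_F(s,H)=\mathbb E_{(v,h)\sim F\times H}\,\mathbb E_{b\sim s(v)}[(v-b)\mathbf 1\{b\ge h\}]$, the regret is $\mathrm{Reg}_F(s,H)=\sup_{s'\in\mathcal S}U_F(s',H)-U_F(s,H)$, and $s\in\mathcal S$ is called minimax-optimal if it minimizes $\sup_{H\in\Delta([0,1])}\mathrm{Reg}_F(s,H)$ over $\mathcal S$. Write $F$ also for the CDF of the value distribution (as a function on $[0,1]$), and let $F^-(t)=\inf\{x\in[0,1]: F(x)\ge t\}$. For a strictly increasing absolutely continuous $Q:[0,1]\to[0,1]$, let $s_Q$ be the strategy that, at value $v$, bids $Q(F(v))$ if $F(\{v\})=0$, and otherwise bids $Q(y)$ with $y$ uniform on $\{y\in[0,1]:F^-(y)=v\}$. **Corollary.** Suppose that $F(0)=0$ and that the CDF of $F$ is continuous. Then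 there exists a strictly increasing absolutely continuous $Q^*:[0,1]\to[0,1]$ with $Q^*(0)=0$, with $0<Q^*(y)<F^-(y)$ for all $y\in(0,1]$, and with $$Q^{*\prime}(y)=\frac{F^-(y)-Q^*(y)}{1-F(Q^*(y))}\quad\text{for almost every }y\in[0,1].$$ Moreover, for every such $Q^*$, the strategy $s_{Q^*}$ is minimax-optimal and deterministic, i.e. for every value $v\in[0,1]$ the bid distribution $s_{Q^*}(v)$ is a point mass at a single bid. -/

import Mathlib

open MeasureTheory
open scoped unitInterval

noncomputable section

namespace FirstPriceAuction

/-- The set of bidding strategies: maps from values in `[0,1]` to bid distributions on `[0,1]`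
that are given by a Markov kernel. -/
def strategies : Set (I → Measure I) :=
  {s | (∀ v, IsProbabilityMeasure (s v)) ∧
    ∀ B : Set I, MeasurableSet B → Measurable fun v => s v B}

/-- Utility of a buyer with value `v` who bids `b` when the highest competing bid is `h`:
the buyer wins iff `b ≥ h`, and then pays `b`. -/
def utility (b h v : I) : ℝ :=
  if h ≤ b then (v : ℝ) - (b : ℝ) else 0

/-- Expected utility of the strategy `s` when `(v, h) ∼ F × H` and `b ∼ s v`. -/
def expectedUtility (F : Measure I) (s : I → Measure I) (H : Measure I) : ℝ :=
  ∫ p : I × I, (∫ b, utility b p.2 p.1 ∂(s p.1)) ∂(F.prod H)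

/-- Regret against the benchmark that knows the distribution `H`. Expected utilities of
strategies lie in `[-1,1]`, so that the supremum is that of a non-empty bounded set. -/
def regret (F : Measure I) (s : I → Measure I) (H : Measure I) : ℝ :=
  (⨆ s' : strategies, expectedUtility F s'.1 H) - expectedUtility F s H

/-- Worst-case regret over all distributions of the highest competing bid. -/
def worstCaseRegret (F : Measure I) (s : I → Measure I) : ℝ :=
  ⨆ H : ProbabilityMeasure I, regret F s (H : Measure I)

/-- A minimizer of the worst-case regret over all bidding strategies. -/
def IsMinimaxOptimal (F : Measure I) (s : I → Measure I) : Prop :=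
  s ∈ strategies ∧ IsMinOn (worstCaseRegret F) strategies s

/-- The strategy places a single bid for every value. -/
def IsDeterministic (s : I → Measure I) : Prop :=
  ∀ v, ∃ b : I, s v = Measure.dirac b

/-- The cumulative distribution function `[0,1] → [0,1]` of a distribution on `[0,1]`. -/
def valueCDF (F : Measure I) [IsProbabilityMeasure F] (x : I) : I :=
  ⟨F.real (Set.Iic x), measureReal_nonneg, measureReal_le_one⟩

/-- The generalized inverse `F⁻(t) = inf {x ∈ [0,1] | F(x) ≥ t}` of the CDF. -/
def quantile (F : Measure I) [IsProbabilityMeasure F] (t : I) : I :=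
  sInf {x : I | t ≤ valueCDF F x}

/-- A quantile-based bidding strategy: a strictly increasing, absolutely continuous map
`[0,1] → [0,1]`. -/
structure IsQuantileBased (Q : I → I) : Prop where
  strictMono : StrictMono Q
  absolutelyContinuous :
    AbsolutelyContinuousOnInterval (Set.IccExtend zero_le_one fun y : I => (Q y : ℝ)) 0 1

/-- The interval of quantiles that correspond to the value `v`. -/
def quantilesOf (F : Measure I) [IsProbabilityMeasure F] (v : I) : Set I :=
  {y | quantile F y = v}

open Classical in
/-- The bidding strategy induced by `Q`: bid `Q (F v)` if `v` is not an atom of `F`;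
otherwise bid `Q y`, where `y` is uniform on the interval of quantiles of `v`. -/
def inducedStrategy (F : Measure I) [IsProbabilityMeasure F] (Q : I → I) (v : I) : Measure I :=
  if F {v} = 0 then Measure.dirac (Q (valueCDF F v))
  else (ProbabilityTheory.cond volume (quantilesOf F v)).map Q

/-- `Q` is a quantile-based bidding strategy that solves the initial value problem
`x'(y) = (F⁻(y) - x(y)) / (1 - F(x(y)))`, `x(0) = 0`, almost everywhere on `[0,1]`, with
`0 < Q(y) < F⁻(y)` for `y ∈ (0,1]`. -/
structure IsODESolution (F : Measure I) [IsProbabilityMeasure F] (Q : I → I) : Prop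
    extends IsQuantileBased Q where
  zero : Q 0 = 0
  ode : ∀ᵐ y : I, HasDerivWithinAt (Set.IccExtend zero_le_one fun y : I => (Q y : ℝ))
    (((quantile F y : ℝ) - (Q y : ℝ)) / (1 - (valueCDF F (Q y) : ℝ))) (Set.Icc 0 1) (y : ℝ)
  pos : ∀ y : I, 0 < y → 0 < Q y
  lt_quantile : ∀ y : I, 0 < y → Q y < quantile F y

end FirstPriceAuction

end

namespace FirstPriceAuction

/-! ### Generalized inverses of continuous distribution functions -/

/-! The proof is a saddle-point argument. With `surplus F h = ∫_h^1 (1 - F)`, regret against `H` is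
at most the `H`-average of `surplus F h - utilityAgainst F s h`, and a point mass at `h` has regret
at least this difference. So only its supremum over `h` matters.

Upper bound: after the change of variables `v = F⁻(y)`, the difference for the induced strategy at
`h = Q t` is `∫_{Q t}^1 (1 - F) - ∫_t^1 (F⁻ - Q)`. The ODE says exactly that this has derivative
zero in `t`, so it equals `surplus F (Q 1)`; competing bids above `Q 1` give no more
(`surplus_sub_utilityAgainst_le`).

Lower bound: let `H` have CDF `exp(-∫_t^1 1 / (1 - F(Q)))` at `Q t`. Against it, `Q y` is a best
response for the value `F⁻(y)` (`mul_bidCDF_le`). Hence every strategy has `H`-average difference at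
least that of the induced one, which is `surplus F (Q 1)` because the difference is constant on the
range of `Q`.

Existence: put `P = ∫_0 F⁻`, `T = ∫_0 (1 - F)` and `u = ∫_0 Q`. Integrating the ODE gives `T(Q) = P
- u`, that is `u' = T⁻¹(P - u)`, whose right-hand side is continuous in time although `F⁻` may jump.
To make `T⁻¹` Lipschitz, `1 - F` is replaced by `max (1 - F) η`. Picard–Lindelöf applies, and a
priori bounds show that for small `η` the solution never reaches the region where the replacement
matters. -/

theorem sInf_setOf_le_le_iff {N : I → I} (hm : Monotone N) (hc : Continuous N) (h1 : N 1 = 1)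
    {t x : I} : sInf {x | t ≤ N x} ≤ x ↔ t ≤ N x := by
  refine ⟨fun h => ?_, fun h => sInf_le h⟩
  have hmem : sInf {x | t ≤ N x} ∈ {x | t ≤ N x} :=
    (isClosed_le continuous_const hc).sInf_mem ⟨1, by simp [h1, unitInterval.le_one']⟩
  exact le_trans hmem (hm h)

theorem monotone_sInf_setOf_le (N : I → I) : Monotone fun t => sInf {x | t ≤ N x} :=
  fun _ _ h => sInf_le_sInf fun _ hx => h.trans hx

/-- Inverse transform sampling. It is stated for a general `N` because it serves both the value
distribution and the worst-case distribution of competing bids. -/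
theorem map_sInf_setOf_le_Iic {N : I → I} (hm : Monotone N) (hc : Continuous N) (h1 : N 1 = 1)
    (x : I) :
    (volume.map fun t => sInf {x | t ≤ N x}) (Set.Iic x) = ENNReal.ofReal (N x) := by
  rw [Measure.map_apply (monotone_sInf_setOf_le N).measurable measurableSet_Iic]
  have : (fun t => sInf {x | t ≤ N x}) ⁻¹' Set.Iic x = Set.Iic (N x) := by
    ext t
    exact sInf_setOf_le_le_iff hm hc h1
  rw [this, unitInterval.volume_Iic]

section CDF

variable (F : Measure I) [IsProbabilityMeasure F]

theorem valueCDF_monotone : Monotone (valueCDF F) := fun _ _ h =>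
  measureReal_mono (Set.Iic_subset_Iic.2 h)

theorem valueCDF_one : valueCDF F 1 = 1 := by
  ext
  have : Set.Iic (1 : I) = Set.univ := Set.eq_univ_of_forall fun x => unitInterval.le_one'
  simp [valueCDF, this]

theorem quantile_monotone : Monotone (quantile F) := monotone_sInf_setOf_le _

variable {F}

theorem quantile_le_iff (hF : Continuous (valueCDF F)) {t x : I} :
    quantile F t ≤ x ↔ t ≤ valueCDF F x :=
  sInf_setOf_le_le_iff (valueCDF_monotone F) hF (valueCDF_one F)

theorem valueCDF_quantile (hF0 : valueCDF F 0 = 0) (hF : Continuous (valueCDF F)) (t : I) :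
    valueCDF F (quantile F t) = t := by
  refine le_antisymm ?_ ((quantile_le_iff hF).1 le_rfl)
  obtain ⟨x, hx⟩ : t ∈ Set.range (valueCDF F) :=
    mem_range_of_exists_le_of_exists_ge hF ⟨0, by simp [hF0]⟩
      ⟨1, by simp [valueCDF_one, unitInterval.le_one']⟩
  exact (valueCDF_monotone F ((quantile_le_iff hF).2 hx.ge)).trans hx.le

theorem quantile_strictMono (hF0 : valueCDF F 0 = 0) (hF : Continuous (valueCDF F)) :
    StrictMono (quantile F) :=
  (quantile_monotone F).strictMono_of_injective
    (Function.LeftInverse.injective (valueCDF_quantile hF0 hF))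

theorem quantile_zero (hF : Continuous (valueCDF F)) : quantile F 0 = 0 :=
  le_antisymm ((quantile_le_iff hF).2 unitInterval.nonneg') unitInterval.nonneg'

theorem map_quantile (hF : Continuous (valueCDF F)) : volume.map (quantile F) = F := by
  have : IsProbabilityMeasure (volume.map (quantile F)) :=
    Measure.isProbabilityMeasure_map (quantile_monotone F).measurable.aemeasurable
  refine Measure.ext_of_Iic _ _ fun x => ?_
  refine (map_sInf_setOf_le_Iic (valueCDF_monotone F) hF (valueCDF_one F) x).trans ?_
  simp [valueCDF]

theorem integral_eq_integral_quantile (hF : Continuous (valueCDF F)) {g : I → ℝ}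
    (hg : Measurable g) : ∫ v, g v ∂F = ∫ y, g (quantile F y) := by
  conv_lhs => rw [← map_quantile hF]
  exact integral_map (quantile_monotone F).measurable.aemeasurable hg.aestronglyMeasurable

/-- The identity can fail only where `F` is flat, and samples `F⁻(y)` avoid these values because
`F(F⁻(y)) = y`. -/
theorem ae_quantile_valueCDF (hF0 : valueCDF F 0 = 0) (hF : Continuous (valueCDF F)) :
    ∀ᵐ v ∂F, quantile F (valueCDF F v) = v := by
  have hm : MeasurableSet {v : I | quantile F (valueCDF F v) = v} :=
    measurableSet_eq_fun ((quantile_monotone F).comp (valueCDF_monotone F)).measurable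
      measurable_id
  have h : ∀ᵐ v ∂(volume.map (quantile F)), quantile F (valueCDF F v) = v :=
    (ae_map_iff (quantile_monotone F).measurable.aemeasurable hm).2
      (.of_forall fun y => by rw [valueCDF_quantile hF0 hF])
  rwa [map_quantile hF] at h

/-- `F` is the image of the uniform distribution under an injective map, so it has no atoms. -/
theorem measure_singleton_eq_zero (hF0 : valueCDF F 0 = 0) (hF : Continuous (valueCDF F)) (v : I) :
    F {v} = 0 := by
  conv_lhs => rw [← map_quantile hF]
  rw [Measure.map_apply (quantile_monotone F).measurable (measurableSet_singleton v)]
  refine Set.Subsingleton.measure_zero ?_ _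
  exact Set.subsingleton_singleton.preimage (quantile_strictMono hF0 hF).injective

theorem isDeterministic_inducedStrategy (hF0 : valueCDF F 0 = 0) (hF : Continuous (valueCDF F))
    (Q : I → I) : IsDeterministic (inducedStrategy F Q) := fun v =>
  ⟨Q (valueCDF F v), by simp [inducedStrategy, measure_singleton_eq_zero hF0 hF]⟩

end CDF

/-! ### The surplus of a fully informed buyer -/

/-- Upper tail `x ↦ 1 - F x` of the value distribution, extended to the real line. -/
noncomputable def tail (F : Measure I) [IsProbabilityMeasure F] (x : ℝ) : ℝ :=
  1 - Set.IccExtend zero_le_one (fun x : I => (valueCDF F x : ℝ)) x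

/-- Expected utility of a buyer who knows the competing bid `h`. -/
noncomputable def surplus (F : Measure I) (h : I) : ℝ :=
  ∫ v : I, max ((v : ℝ) - h) 0 ∂F

section Tail

variable (F : Measure I) [IsProbabilityMeasure F]

theorem tail_coe (x : I) : tail F x = 1 - valueCDF F x := by
  simp [tail]

theorem tail_antitone : Antitone (tail F) := fun _ _ h =>
  sub_le_sub_left (α := ℝ) (valueCDF_monotone F (Set.monotone_projIcc zero_le_one h)) 1

theorem tail_nonneg (x : ℝ) : 0 ≤ tail F x :=
  sub_nonneg.2 (valueCDF F _).2.2

theorem tail_le_one (x : ℝ) : tail F x ≤ 1 :=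
  sub_le_self _ (valueCDF F _).2.1

theorem tail_of_one_le {x : ℝ} (hx : 1 ≤ x) : tail F x = 0 := by
  simp [tail, Set.IccExtend_of_right_le zero_le_one _ hx, valueCDF_one]

theorem intervalIntegrable_tail (a b : ℝ) : IntervalIntegrable (tail F) volume a b :=
  (tail_antitone F).intervalIntegrable

variable {F}

theorem tail_continuous (hF : Continuous (valueCDF F)) : Continuous (tail F) := by
  exact continuous_const.sub (continuous_subtype_val.comp hF).Icc_extend'

variable (F)

/-- Layer-cake formula for the positive part of `v - h`. -/
theorem surplus_eq (h : I) : surplus F h = ∫ x in (h : ℝ)..1, tail F x := by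
  have hint : Integrable (fun v : I => max ((v : ℝ) - h) 0) F :=
    Integrable.of_bound (by fun_prop) 1 (.of_forall fun v => by
      rw [Real.norm_of_nonneg (le_max_right _ _)]
      exact max_le (by linarith [v.2.2, h.2.1]) zero_le_one)
  rw [surplus, hint.integral_eq_integral_meas_lt (.of_forall fun _ => le_max_right _ _)]
  have hset : ∀ t ∈ Set.Ioi (0 : ℝ),
      F.real {v : I | t < max ((v : ℝ) - h) 0} = tail F (h + t) := by
    intro t (ht : 0 < t)
    by_cases h1 : h + t ≤ 1
    · have hx : (h : ℝ) + t ∈ Set.Icc (0 : ℝ) 1 := ⟨by linarith [h.2.1], h1⟩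
      have : {v : I | t < max ((v : ℝ) - h) 0} = (Set.Iic (⟨h + t, hx⟩ : I))ᶜ := by
        ext v
        simp only [Set.mem_ofPred_eq, lt_max_iff, Set.mem_compl_iff, Set.mem_Iic, not_le,
          ← Subtype.coe_lt_coe]
        constructor
        · rintro (h | h) <;> linarith
        · intro h; left; linarith
      rw [this, probReal_compl_eq_one_sub measurableSet_Iic]
      exact (tail_coe F ⟨h + t, hx⟩).symm
    · rw [tail_of_one_le F (le_of_not_ge h1)]
      have : {v : I | t < max ((v : ℝ) - h) 0} = ∅ := by
        ext v
        simp only [Set.mem_ofPred_eq, lt_max_iff, Set.mem_empty_iff_false, iff_false, not_or, not_lt]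
        exact ⟨by linarith [v.2.2], ht.le⟩
      rw [this, measureReal_empty]
  rw [setIntegral_congr_fun measurableSet_Ioi hset]
  have hh : (0 : ℝ) ≤ 1 - h := by linarith [h.2.2]
  rw [setIntegral_eq_of_subset_of_forall_sdiff_eq_zero measurableSet_Ioi
    (Set.Ioc_subset_Ioi_self : Set.Ioc 0 (1 - (h : ℝ)) ⊆ Set.Ioi 0),
    ← intervalIntegral.integral_of_le hh, intervalIntegral.integral_comp_add_left]
  · simp
  · rintro x ⟨hx0, hx1⟩
    refine tail_of_one_le F ?_
    by_contra hc
    exact hx1 ⟨hx0, by linarith⟩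

theorem surplus_sub_surplus (h k : I) :
    surplus F h - surplus F k = ∫ x in (h : ℝ)..k, tail F x := by
  rw [surplus_eq, surplus_eq, sub_eq_iff_eq_add]
  exact (intervalIntegral.integral_add_adjacent_intervals (intervalIntegrable_tail F _ _)
    (intervalIntegrable_tail F _ _)).symm

theorem surplus_antitone : Antitone (surplus F) := fun h k hk => by
  rw [← sub_nonneg, surplus_sub_surplus]
  exact intervalIntegral.integral_nonneg hk fun x _ => tail_nonneg F x

end Tail

end FirstPriceAuction

namespace FirstPriceAuction

/-! ### Expected utilities -/

theorem measurable_utility : Measurable fun p : I × I × I => utility p.1 p.2.1 p.2.2 := by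
  unfold utility
  exact Measurable.ite (measurableSet_le (by fun_prop) (by fun_prop)) (by fun_prop) (by fun_prop)

theorem abs_utility_le (b h v : I) : |utility b h v| ≤ 1 := by
  unfold utility
  split_ifs
  · exact abs_le.2 ⟨by linarith [v.2.1, b.2.2], by linarith [v.2.2, b.2.1]⟩
  · simp

theorem utility_le_max (b h v : I) : utility b h v ≤ max ((v : ℝ) - h) 0 := by
  unfold utility
  split_ifs with hb
  · exact le_max_of_le_left (sub_le_sub_left (α := ℝ) hb _)
  · exact le_max_right _ _

/-- A buyer who knows `h` matches it when `h ≤ v`, winning the tie, and loses on purpose otherwise.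
This attains the pointwise bound `utility_le_max`. -/
theorem utility_min (h v : I) : utility (min v h) h v = max ((v : ℝ) - h) 0 := by
  unfold utility
  rcases le_or_gt h v with hv | hv
  · rw [min_eq_right hv, if_pos le_rfl, max_eq_left (sub_nonneg.2 (show (h : ℝ) ≤ v from hv))]
  · rw [min_eq_left hv.le, if_neg (not_le.2 hv),
      max_eq_right (sub_nonpos.2 (show (v : ℝ) ≤ h from hv.le))]

theorem dirac_mem_strategies {f : I → I} (hf : Measurable f) :
    (fun v => Measure.dirac (f v)) ∈ strategies :=
  ⟨fun _ => inferInstance, fun B hB => by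
    simp only [Measure.dirac_apply' _ hB]
    exact (measurable_one.indicator hB).comp hf⟩

/-- Expected utility of a buyer with value `v` against the competing bid `h`. -/
noncomputable def bidUtility (s : I → Measure I) (v h : I) : ℝ :=
  ∫ b, utility b h v ∂(s v)

theorem abs_integral_le_one {X : Type*} [MeasurableSpace X] {μ : Measure X} [IsProbabilityMeasure μ]
    {f : X → ℝ} (hf : ∀ x, |f x| ≤ 1) : |∫ x, f x ∂μ| ≤ 1 := by
  simpa using norm_integral_le_of_norm_le_const (μ := μ) (f := f) (C := 1) (.of_forall hf)

theorem integrable_of_abs_le_one {X : Type*} [MeasurableSpace X] {μ : Measure X}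
    [IsProbabilityMeasure μ] {f : X → ℝ} (hm : Measurable f) (hf : ∀ x, |f x| ≤ 1) :
    Integrable f μ :=
  .of_bound hm.aestronglyMeasurable 1 (.of_forall hf)

section Strategy

variable {s : I → Measure I}

theorem abs_bidUtility_le (hs : s ∈ strategies) (v h : I) : |bidUtility s v h| ≤ 1 :=
  have := hs.1 v
  abs_integral_le_one fun b => abs_utility_le b h v

theorem measurable_bidUtility (hs : s ∈ strategies) :
    Measurable fun p : I × I => bidUtility s p.1 p.2 := by
  let κ : ProbabilityTheory.Kernel I I := ⟨s, Measure.measurable_of_measurable_coe _ hs.2⟩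
  have : ProbabilityTheory.IsMarkovKernel κ := ⟨hs.1⟩
  have hu : StronglyMeasurable (Function.uncurry fun (p : I × I) (b : I) => utility b p.2 p.1) :=
    (measurable_utility.comp (f := fun q : (I × I) × I => (q.2, q.1.2, q.1.1))
      (by fun_prop)).stronglyMeasurable
  exact (hu.integral_kernel_prod_right (κ := κ.comap Prod.fst measurable_fst)).measurable

variable (F : Measure I) [IsProbabilityMeasure F]

/-- Expected utility of a strategy against the competing bid `h`. -/
noncomputable def utilityAgainst (s : I → Measure I) (h : I) : ℝ :=
  ∫ v, bidUtility s v h ∂F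

variable {F}

theorem integrable_bidUtility (hs : s ∈ strategies) (h : I) :
    Integrable (fun v => bidUtility s v h) F :=
  integrable_of_abs_le_one ((measurable_bidUtility hs).comp (f := fun v => (v, h)) (by fun_prop))
    fun v => abs_bidUtility_le hs v h

theorem abs_utilityAgainst_le (hs : s ∈ strategies) (h : I) : |utilityAgainst F s h| ≤ 1 :=
  abs_integral_le_one fun v => abs_bidUtility_le hs v h

theorem measurable_utilityAgainst (hs : s ∈ strategies) : Measurable (utilityAgainst F s) :=
  (StronglyMeasurable.integral_prod_right (f := fun h v => bidUtility s v h)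
    ((measurable_bidUtility hs).comp measurable_swap).stronglyMeasurable).measurable

variable (H : Measure I) [IsProbabilityMeasure H]

theorem expectedUtility_eq_integral_utilityAgainst (hs : s ∈ strategies) :
    expectedUtility F s H = ∫ h, utilityAgainst F s h ∂H :=
  integral_prod_symm _ (integrable_of_abs_le_one (measurable_bidUtility hs)
    fun p => abs_bidUtility_le hs p.1 p.2)

theorem expectedUtility_eq_integral_bidUtility (hs : s ∈ strategies) :
    expectedUtility F s H = ∫ v, ∫ h, bidUtility s v h ∂H ∂F :=
  integral_prod _ (integrable_of_abs_le_one (measurable_bidUtility hs)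
    fun p => abs_bidUtility_le hs p.1 p.2)

theorem abs_expectedUtility_le (hs : s ∈ strategies) : |expectedUtility F s H| ≤ 1 := by
  rw [expectedUtility_eq_integral_utilityAgainst H hs]
  exact abs_integral_le_one fun h => abs_utilityAgainst_le hs h

theorem integrable_utilityAgainst (hs : s ∈ strategies) : Integrable (utilityAgainst F s) H :=
  integrable_of_abs_le_one (measurable_utilityAgainst hs) (abs_utilityAgainst_le hs)

theorem integrable_max_sub (h : I) : Integrable (fun v : I => max ((v : ℝ) - h) 0) F :=
  integrable_of_abs_le_one (by fun_prop) fun v => by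
    rw [abs_of_nonneg (le_max_right _ _)]
    exact max_le (by linarith [v.2.2, h.2.1]) zero_le_one

theorem utilityAgainst_le_surplus (hs : s ∈ strategies) (h : I) :
    utilityAgainst F s h ≤ surplus F h := by
  refine integral_mono (integrable_bidUtility hs h) (integrable_max_sub h) fun v => ?_
  have := hs.1 v
  calc ∫ b, utility b h v ∂(s v) ≤ ∫ _, max ((v : ℝ) - h) 0 ∂(s v) :=
        integral_mono (integrable_of_abs_le_one
          (measurable_utility.comp (f := fun b => (b, h, v)) (by fun_prop))
          fun b => abs_utility_le b h v) (integrable_const _) fun b => utility_le_max b h v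
    _ = _ := by simp

theorem bddAbove_expectedUtility :
    BddAbove (Set.range fun s' : strategies => expectedUtility F s'.1 H) :=
  ⟨1, Set.forall_mem_range.2 fun s' => (abs_le.1 (abs_expectedUtility_le H s'.2)).2⟩

instance nonempty_strategies : Nonempty strategies :=
  ⟨⟨_, dirac_mem_strategies measurable_id⟩⟩

theorem integrable_surplus : Integrable (surplus F) H := by
  refine integrable_of_abs_le_one (surplus_antitone F).measurable fun h => ?_
  refine abs_integral_le_one fun v => ?_
  rw [abs_of_nonneg (le_max_right _ _)]
  exact max_le (by linarith [v.2.2, h.2.1]) zero_le_one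

/-- The benchmark knows only the distribution `H`, so knowing the realized `h` can only help it. -/
theorem regret_le_integral (hs : s ∈ strategies) :
    regret F s H ≤ ∫ h, (surplus F h - utilityAgainst F s h) ∂H := by
  rw [integral_sub (integrable_surplus H) (integrable_utilityAgainst H hs), regret,
    expectedUtility_eq_integral_utilityAgainst H hs]
  refine sub_le_sub_right (ciSup_le fun s' => ?_) _
  rw [expectedUtility_eq_integral_utilityAgainst H s'.2]
  exact integral_mono (integrable_utilityAgainst H s'.2) (integrable_surplus H)
    fun h => utilityAgainst_le_surplus s'.2 h

/-- For a point mass, knowing the distribution means knowing `h`; the benchmark bids `min v h`. -/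
theorem surplus_sub_utilityAgainst_le_regret (hs : s ∈ strategies) (h : I) :
    surplus F h - utilityAgainst F s h ≤ regret F s (Measure.dirac h) := by
  have hm : (fun v => Measure.dirac (min v h)) ∈ strategies :=
    dirac_mem_strategies (f := fun v => min v h) (by fun_prop)
  have hle := le_ciSup (bddAbove_expectedUtility (F := F) (Measure.dirac h)) ⟨_, hm⟩
  have h1 : ∀ {t : I → Measure I}, t ∈ strategies →
      expectedUtility F t (Measure.dirac h) = utilityAgainst F t h := fun ht => by
    rw [expectedUtility_eq_integral_utilityAgainst _ ht, integral_dirac]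
  have h2 : utilityAgainst F (fun v => Measure.dirac (min v h)) h = surplus F h := by
    simp only [utilityAgainst, bidUtility, integral_dirac, utility_min, surplus]
  rw [regret, h1 hs, ← h2, ← h1 hm]
  exact sub_le_sub_right hle _

theorem worstCaseRegret_le {c : ℝ} (hs : s ∈ strategies)
    (hc : ∀ h, surplus F h - utilityAgainst F s h ≤ c) : worstCaseRegret F s ≤ c := by
  have : Nonempty (ProbabilityMeasure I) := ⟨⟨Measure.dirac 0, inferInstance⟩⟩
  refine ciSup_le fun H => (regret_le_integral _ hs).trans ?_
  calc _ ≤ ∫ _, c ∂(H : Measure I) :=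
        integral_mono ((integrable_surplus _).sub (integrable_utilityAgainst _ hs))
          (integrable_const _) hc
    _ = c := by simp

theorem surplus_sub_utilityAgainst_le_worstCaseRegret (hs : s ∈ strategies) (h : I) :
    surplus F h - utilityAgainst F s h ≤ worstCaseRegret F s := by
  have hbdd : BddAbove (Set.range fun H : ProbabilityMeasure I => regret F s (H : Measure I)) := by
    refine ⟨2, Set.forall_mem_range.2 fun H => ?_⟩
    have h1 := (abs_le.1 (abs_expectedUtility_le (F := F) (H : Measure I) hs)).1
    have h2 : (⨆ s' : strategies, expectedUtility F s'.1 (H : Measure I)) ≤ 1 :=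
      ciSup_le fun s' => (abs_le.1 (abs_expectedUtility_le _ s'.2)).2
    rw [regret]
    linarith
  exact (surplus_sub_utilityAgainst_le_regret hs h).trans
    (le_ciSup hbdd ⟨Measure.dirac h, inferInstance⟩)

theorem integral_bidUtility_eq (hs : s ∈ strategies) (v : I) :
    ∫ h, bidUtility s v h ∂H = ∫ b : I, ((v : ℝ) - b) * H.real (Set.Iic b) ∂(s v) := by
  have := hs.1 v
  have hu : Measurable fun p : I × I => utility p.2 p.1 v :=
    measurable_utility.comp (f := fun p : I × I => (p.2, p.1, v)) (by fun_prop)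
  unfold bidUtility
  rw [integral_integral_swap (f := fun h b => utility b h v)
    (integrable_of_abs_le_one hu fun p => abs_utility_le _ _ _)]
  refine integral_congr_ae (.of_forall fun b => ?_)
  have : (fun h => utility b h v) = (Set.Iic b).indicator fun _ => (v : ℝ) - b := by
    ext h
    simp [utility, Set.indicator_apply]
  simp only [this, integral_indicator_const _ measurableSet_Iic, smul_eq_mul, mul_comm]

end Strategy

end FirstPriceAuction

namespace FirstPriceAuction

/-! ### Analysis on the unit interval -/

theorem integral_unitInterval_eq (f : ℝ → ℝ) : ∫ y : I, f y = ∫ t in (0 : ℝ)..1, f t := by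
  rw [unitInterval.measurePreserving_coe.integral_comp unitInterval.measurableEmbedding_coe f,
    intervalIntegral.integral_of_le zero_le_one, integral_Icc_eq_integral_Ioc]

theorem integral_unitInterval_indicator_Ici (f : ℝ → ℝ) (t : I) :
    ∫ y : I, (Set.Ici t).indicator (fun y => f y) y = ∫ τ in (t : ℝ)..1, f τ := by
  have h : ∀ y : I, (Set.Ici t).indicator (fun y : I => f y) y
      = (Set.Ici (t : ℝ)).indicator f y := fun y => by
    simp only [Set.indicator_apply, Set.mem_Ici, Subtype.coe_le_coe]
  simp only [h]
  rw [unitInterval.measurePreserving_coe.integral_comp unitInterval.measurableEmbedding_coe,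
    integral_indicator measurableSet_Ici, Measure.restrict_restrict measurableSet_Ici,
    intervalIntegral.integral_of_le t.2.2, ← integral_Icc_eq_integral_Ioc]
  congr 2
  ext x
  simp only [Set.mem_inter_iff, Set.mem_Ici, Set.mem_Icc]
  exact ⟨fun h => ⟨h.1, h.2.2⟩, fun h => ⟨h.1, t.2.1.trans h.1, h.2⟩⟩

theorem ae_unitInterval_iff {p : ℝ → Prop} :
    (∀ᵐ y : I, p y) ↔ ∀ᵐ t : ℝ, t ∈ Set.Icc (0 : ℝ) 1 → p t := by
  rw [← ae_restrict_iff' measurableSet_Icc, ← unitInterval.measurePreserving_coe.map_eq,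
    unitInterval.measurableEmbedding_coe.ae_map_iff]

/-- Fundamental theorem of calculus for absolutely continuous functions; the endpoints form a null
set, so interior derivatives suffice. -/
theorem sub_eq_integral_of_ae_hasDerivAt {f f' : ℝ → ℝ}
    (hf : AbsolutelyContinuousOnInterval f 0 1)
    (hf' : ∀ᵐ t : ℝ, t ∈ Set.Ioo (0 : ℝ) 1 → HasDerivAt f (f' t) t) {x y : ℝ}
    (hx : x ∈ Set.Icc (0 : ℝ) 1) (hy : y ∈ Set.Icc (0 : ℝ) 1) :
    f y - f x = ∫ t in x..y, f' t := by
  have hsub : Set.uIcc x y ⊆ Set.Icc 0 1 := Set.uIcc_subset_Icc hx hy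
  rw [← (hf.mono (by rwa [Set.uIcc_of_le zero_le_one])).integral_deriv_eq_sub]
  refine intervalIntegral.integral_congr_ae ?_
  filter_upwards [hf', Measure.ae_ne volume 0, Measure.ae_ne volume 1] with t ht h0 h1 hmem
  have h := hsub (Set.uIoc_subset_uIcc hmem)
  exact (ht ⟨lt_of_le_of_ne h.1 h0.symm, lt_of_le_of_ne h.2 h1⟩).deriv

/-! ### Solutions of the initial value problem -/

/-- Extension of a map `[0,1] → [0,1]` to the real line that is constant outside of `[0,1]`. -/
noncomputable def extend (Q : I → I) : ℝ → ℝ :=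
  Set.IccExtend zero_le_one fun y : I => (Q y : ℝ)

theorem extend_coe (Q : I → I) (y : I) : extend Q y = Q y := by simp [extend]

theorem extend_of_mem (Q : I → I) {t : ℝ} (ht : t ∈ Set.Icc (0 : ℝ) 1) :
    extend Q t = Q ⟨t, ht⟩ := extend_coe Q ⟨t, ht⟩

theorem extend_mem (Q : I → I) (t : ℝ) : extend Q t ∈ Set.Icc (0 : ℝ) 1 := (Q _).2

theorem extend_monotone {Q : I → I} (hQ : Monotone Q) : Monotone (extend Q) :=
  fun _ _ h => hQ (Set.monotone_projIcc zero_le_one h)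

namespace IsODESolution

variable {F : Measure I} [IsProbabilityMeasure F] {Q : I → I}

theorem continuous_coe (hQ : IsODESolution F Q) : Continuous fun y : I => (Q y : ℝ) := by
  have h := hQ.absolutelyContinuous.continuousOn
  rw [Set.uIcc_of_le zero_le_one] at h
  exact (h.comp_continuous continuous_subtype_val fun y => y.2).congr fun y => extend_coe Q y

theorem continuous (hQ : IsODESolution F Q) : Continuous Q :=
  hQ.continuous_coe.subtype_mk fun y => (Q y).2

theorem continuous_extend (hQ : IsODESolution F Q) : Continuous (extend Q) :=
  hQ.continuous_coe.Icc_extend'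

/-- `Q 1 < F⁻(1)` forces `F(Q 1) < 1`. By monotonicity this keeps the denominator of the ODE
uniformly away from zero. -/
theorem tail_one_pos (hQ : IsODESolution F Q) (hF : Continuous (valueCDF F)) :
    0 < tail F (Q 1) := by
  rw [tail_coe, sub_pos]
  have h := hQ.lt_quantile 1 zero_lt_one
  by_contra hc
  exact h.not_ge ((quantile_le_iff hF).2 (not_lt.1 hc))

theorem tail_one_le (hQ : IsODESolution F Q) (t : ℝ) : tail F (Q 1) ≤ tail F (extend Q t) :=
  tail_antitone F (hQ.strictMono.monotone unitInterval.le_one')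

theorem tail_pos (hQ : IsODESolution F Q) (hF : Continuous (valueCDF F)) (t : ℝ) :
    0 < tail F (extend Q t) :=
  (hQ.tail_one_pos hF).trans_le (hQ.tail_one_le t)

theorem hasDerivAt (hQ : IsODESolution F Q) : ∀ᵐ t : ℝ, t ∈ Set.Ioo (0 : ℝ) 1 →
    HasDerivAt (extend Q)
      ((extend (quantile F) t - extend Q t) / tail F (extend Q t)) t := by
  have h : ∀ᵐ y : I, HasDerivWithinAt (extend Q)
      ((extend (quantile F) y - extend Q y) / tail F (extend Q y)) (Set.Icc 0 1) y := by
    filter_upwards [hQ.ode] with y hy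
    rwa [extend_coe, extend_coe, tail_coe]
  rw [ae_unitInterval_iff (p := fun t => HasDerivWithinAt (extend Q)
      ((extend (quantile F) t - extend Q t) / tail F (extend Q t)) (Set.Icc 0 1) t)] at h
  filter_upwards [h] with t ht hmem
  exact (ht ⟨hmem.1.le, hmem.2.le⟩).hasDerivAt (Icc_mem_nhds hmem.1 hmem.2)

theorem lipschitzOnWith (hQ : IsODESolution F Q) (hF : Continuous (valueCDF F)) :
    ∃ C, LipschitzOnWith C (extend Q) (Set.Icc 0 1) := by
  have hpos := hQ.tail_one_pos hF
  refine ⟨(1 / tail F (Q 1)).toNNReal, LipschitzOnWith.of_dist_le_mul fun x hx y hy => ?_⟩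
  rw [Real.dist_eq, Real.dist_eq, Real.coe_toNNReal _ (by positivity),
    sub_eq_integral_of_ae_hasDerivAt (f := extend Q) hQ.absolutelyContinuous hQ.hasDerivAt hy hx]
  refine intervalIntegral.norm_integral_le_of_norm_le_const (E := ℝ) fun t _ => ?_
  rw [norm_div, Real.norm_of_nonneg (tail_nonneg F _)]
  refine div_le_div₀ zero_le_one ?_ hpos (hQ.tail_one_le t)
  have h1 := extend_mem (quantile F) t
  have h2 := extend_mem Q t
  exact abs_le.2 ⟨by linarith [h1.1, h2.2], by linarith [h1.2, h2.1]⟩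

/-- By the chain rule and the ODE, `t ↦ ∫_{Q t}^1 (1 - F)` has derivative `-(F⁻ - Q)` almost
everywhere. The Lipschitz bound on `Q` makes this composition absolutely continuous. -/
theorem surplus_sub_integral (hQ : IsODESolution F Q) (hF : Continuous (valueCDF F)) (t : I) :
    surplus F (Q t) - ∫ τ in (t : ℝ)..1, (extend (quantile F) τ - extend Q τ)
      = surplus F (Q 1) := by
  obtain ⟨C, hC⟩ := hQ.lipschitzOnWith hF
  let S : ℝ → ℝ := fun x => ∫ u in x..(1 : ℝ), tail F u
  have hS : ∀ x, HasDerivAt S (-tail F x) x := fun x =>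
    intervalIntegral.integral_hasDerivAt_left (intervalIntegrable_tail F _ _)
      ((tail_continuous hF).stronglyMeasurableAtFilter _ _) (tail_continuous hF).continuousAt
  have hSL : LipschitzWith 1 S :=
    lipschitzWith_of_nnnorm_deriv_le (fun x => (hS x).differentiableAt) fun x => by
      rw [(hS x).deriv, nnnorm_neg, ← NNReal.coe_le_coe, coe_nnnorm, NNReal.coe_one,
        Real.norm_of_nonneg (tail_nonneg F x)]
      exact tail_le_one F x
  have hAC : AbsolutelyContinuousOnInterval (S ∘ extend Q) 0 1 :=
    LipschitzOnWith.absolutelyContinuousOnInterval (K := 1 * C)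
      <| by
      rw [Set.uIcc_of_le zero_le_one]
      exact (hSL.lipschitzOnWith (s := Set.univ)).comp hC (Set.mapsTo_univ _ _)
  have hd : ∀ᵐ τ : ℝ, τ ∈ Set.Ioo (0 : ℝ) 1 →
      HasDerivAt (S ∘ extend Q) (-(extend (quantile F) τ - extend Q τ)) τ := by
    filter_upwards [hQ.hasDerivAt] with τ hτ hmem
    have hne := (hQ.tail_pos hF τ).ne'
    refine ((hS _).comp τ (hτ hmem)).congr_deriv ?_
    field_simp
  have h := sub_eq_integral_of_ae_hasDerivAt hAC hd t.2
    (Set.right_mem_Icc.2 zero_le_one)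
  have h1 := extend_coe Q 1
  rw [Set.Icc.coe_one] at h1
  rw [intervalIntegral.integral_neg, Function.comp, Function.comp, extend_coe, h1] at h
  rw [surplus_eq, surplus_eq F (Q 1)]
  change S (Q t) - _ = S (Q 1)
  linarith

/-! ### Equalized regret of the induced strategy -/

section InducedStrategy

theorem inducedStrategy_eq (hF0 : valueCDF F 0 = 0) (hF : Continuous (valueCDF F)) :
    inducedStrategy F Q = fun v => Measure.dirac (Q (valueCDF F v)) := by
  ext1 v
  simp [inducedStrategy, measure_singleton_eq_zero hF0 hF]

theorem inducedStrategy_mem (hQ : IsODESolution F Q) (hF0 : valueCDF F 0 = 0)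
    (hF : Continuous (valueCDF F)) : inducedStrategy F Q ∈ strategies := by
  rw [inducedStrategy_eq hF0 hF]
  exact dirac_mem_strategies (hQ.continuous.comp hF).measurable

theorem utilityAgainst_inducedStrategy (hQ : IsODESolution F Q) (hF0 : valueCDF F 0 = 0)
    (hF : Continuous (valueCDF F)) (h : I) :
    utilityAgainst F (inducedStrategy F Q) h = ∫ y, utility (Q y) h (quantile F y) := by
  rw [inducedStrategy_eq hF0 hF]
  simp only [utilityAgainst, bidUtility, integral_dirac]
  refine (integral_eq_integral_quantile hF
    (measurable_utility.comp (f := fun v => (Q (valueCDF F v), h, v))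
      ((hQ.continuous.comp hF).measurable.prodMk (by fun_prop)))).trans ?_
  simp only [Function.comp_apply, valueCDF_quantile hF0 hF]

theorem surplus_sub_utilityAgainst_apply (hQ : IsODESolution F Q) (hF0 : valueCDF F 0 = 0)
    (hF : Continuous (valueCDF F)) (t : I) :
    surplus F (Q t) - utilityAgainst F (inducedStrategy F Q) (Q t) = surplus F (Q 1) := by
  rw [← hQ.surplus_sub_integral hF t, utilityAgainst_inducedStrategy hQ hF0 hF,
    ← integral_unitInterval_indicator_Ici]
  congr 2
  ext y
  simp only [utility, Set.indicator_apply, Set.mem_Ici, hQ.strictMono.le_iff_le, extend_coe]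

theorem exists_apply_eq (hQ : IsODESolution F Q) {b : I} (hb : b ≤ Q 1) : ∃ t, Q t = b :=
  mem_range_of_exists_le_of_exists_ge hQ.continuous
    ⟨0, by rw [hQ.zero]; exact unitInterval.nonneg'⟩ ⟨1, hb⟩

theorem surplus_sub_utilityAgainst_le (hQ : IsODESolution F Q) (hF0 : valueCDF F 0 = 0)
    (hF : Continuous (valueCDF F)) (h : I) :
    surplus F h - utilityAgainst F (inducedStrategy F Q) h ≤ surplus F (Q 1) := by
  rcases le_or_gt h (Q 1) with hle | hlt
  · obtain ⟨t, rfl⟩ := hQ.exists_apply_eq hle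
    exact (hQ.surplus_sub_utilityAgainst_apply hF0 hF t).le
  · have : utilityAgainst F (inducedStrategy F Q) h = 0 := by
      rw [utilityAgainst_inducedStrategy hQ hF0 hF]
      refine integral_eq_zero_of_ae (.of_forall fun y => ?_)
      have : ¬ h ≤ Q y := not_le.2 ((hQ.strictMono.monotone unitInterval.le_one').trans_lt hlt)
      simp [utility, this]
    rw [this, sub_zero]
    exact surplus_antitone F hlt.le

end InducedStrategy

end IsODESolution

end FirstPriceAuction

namespace FirstPriceAuction

namespace IsODESolution

variable {F : Measure I} [IsProbabilityMeasure F] {Q : I → I}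

/-! ### The worst-case distribution of the highest competing bid -/

variable (F Q) in
/-- The worst-case distribution of the highest competing bid, as a function of the quantile `t`
whose bid `Q t` it is evaluated at. -/
noncomputable def bidCDF (t : ℝ) : ℝ := Real.exp (-∫ τ in t..1, (tail F (extend Q τ))⁻¹)

theorem continuous_inv_tail (hQ : IsODESolution F Q) (hF : Continuous (valueCDF F)) :
    Continuous fun t => (tail F (extend Q t))⁻¹ :=
  ((tail_continuous hF).comp hQ.continuous_extend).inv₀ fun t => (hQ.tail_pos hF t).ne'

theorem hasDerivAt_bidCDF (hQ : IsODESolution F Q) (hF : Continuous (valueCDF F)) (t : ℝ) :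
    HasDerivAt (bidCDF F Q) (bidCDF F Q t * (tail F (extend Q t))⁻¹) t := by
  have hc := hQ.continuous_inv_tail hF
  have h := intervalIntegral.integral_hasDerivAt_left (hc.intervalIntegrable t 1)
    (hc.stronglyMeasurableAtFilter _ _) hc.continuousAt
  exact h.neg.exp.congr_deriv (by rw [neg_neg]; rfl)

theorem bidCDF_pos (t : ℝ) : 0 < bidCDF F Q t := Real.exp_pos _

theorem bidCDF_one : bidCDF F Q 1 = 1 := by simp [bidCDF]

theorem bidCDF_monotone (hQ : IsODESolution F Q) (hF : Continuous (valueCDF F)) :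
    Monotone (bidCDF F Q) :=
  monotone_of_deriv_nonneg (fun t => (hQ.hasDerivAt_bidCDF hF t).differentiableAt) fun t => by
    rw [(hQ.hasDerivAt_bidCDF hF t).deriv]
    exact mul_nonneg (bidCDF_pos t).le (inv_nonneg.2 (hQ.tail_pos hF t).le)

theorem absolutelyContinuous_bidCDF (hQ : IsODESolution F Q) (hF : Continuous (valueCDF F)) :
    AbsolutelyContinuousOnInterval (bidCDF F Q) 0 1 := by
  have hd : Differentiable ℝ (bidCDF F Q) := fun t => (hQ.hasDerivAt_bidCDF hF t).differentiableAt
  refine (contDiff_one_iff_deriv.2 ⟨hd, ?_⟩).contDiffOn.absolutelyContinuousOnInterval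
  rw [funext fun t => (hQ.hasDerivAt_bidCDF hF t).deriv]
  exact hd.continuous.mul (hQ.continuous_inv_tail hF)

/-- Against the worst-case distribution of competing bids, a buyer whose value is the quantile of
`y` optimally bids `Q y`. -/
theorem mul_bidCDF_le (hQ : IsODESolution F Q) (hF : Continuous (valueCDF F)) (y t : I) :
    ((quantile F y : ℝ) - Q t) * bidCDF F Q t ≤ ((quantile F y : ℝ) - Q y) * bidCDF F Q y := by
  set v : ℝ := ((quantile F y : I) : ℝ) with hv
  obtain ⟨C, hC⟩ := hQ.lipschitzOnWith hF
  have hAC : AbsolutelyContinuousOnInterval (fun τ => (v - extend Q τ) * bidCDF F Q τ) 0 1 := by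
    have h0 : AbsolutelyContinuousOnInterval (fun _ => v) 0 1 :=
      LipschitzOnWith.absolutelyContinuousOnInterval (K := 0) (LipschitzWith.const v).lipschitzOnWith
    exact (h0.sub hQ.absolutelyContinuous).mul (hQ.absolutelyContinuous_bidCDF hF)
  -- The ODE and `B' = B / (1 - F(Q))`, for `B` the `bidCDF`, reduce the derivative of `(v - Q) B`
  -- to a nonnegative weight times `v - F⁻(τ)`. This is nonnegative before `y` and nonpositive after
  -- it, so the maximum is at `y`.
  have hd : ∀ᵐ τ : ℝ, τ ∈ Set.Ioo (0 : ℝ) 1 →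
      HasDerivAt (fun τ => (v - extend Q τ) * bidCDF F Q τ)
        (bidCDF F Q τ * (tail F (extend Q τ))⁻¹ * (v - extend (quantile F) τ)) τ := by
    filter_upwards [hQ.hasDerivAt] with τ hτ hmem
    refine (((hτ hmem).const_sub v).mul (hQ.hasDerivAt_bidCDF hF τ)).congr_deriv ?_
    have hne := (hQ.tail_pos hF τ).ne'
    field_simp
    ring
  have h := sub_eq_integral_of_ae_hasDerivAt hAC hd t.2 y.2
  simp only [extend_coe] at h
  rw [← sub_nonneg, h]
  have hw : ∀ τ, 0 ≤ bidCDF F Q τ * (tail F (extend Q τ))⁻¹ := fun τ =>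
    mul_nonneg (bidCDF_pos τ).le (inv_nonneg.2 (hQ.tail_pos hF τ).le)
  have hq := extend_monotone (quantile_monotone F)
  have hvy : v = extend (quantile F) y := (extend_coe _ y).symm
  rcases le_total t y with hty | hty
  · refine intervalIntegral.integral_nonneg hty fun τ hτ => mul_nonneg (hw τ) (sub_nonneg.2 ?_)
    exact (hq hτ.2).trans hvy.ge
  · rw [intervalIntegral.integral_symm, ← intervalIntegral.integral_neg]
    refine intervalIntegral.integral_nonneg hty fun τ hτ => ?_
    rw [← mul_neg]
    refine mul_nonneg (hw τ) (neg_nonneg.2 (sub_nonpos.2 ?_))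
    exact hvy.le.trans (hq hτ.1)

/-- There is a distribution of competing bids, supported on the range of `Q`, whose distribution
function at `Q t` is `bidCDF F Q t`. -/
theorem exists_measure_bidCDF (hQ : IsODESolution F Q) (hF : Continuous (valueCDF F)) :
    ∃ H : Measure I, IsProbabilityMeasure H ∧ (∀ t, H.real (Set.Iic (Q t)) = bidCDF F Q t) ∧
      ∀ f : I → ℝ, Measurable f → ∀ c, (∀ t, f (Q t) = c) → ∫ h, f h ∂H = c := by
  have hmono := hQ.bidCDF_monotone hF
  let N : I → I := fun t =>
    ⟨bidCDF F Q t, (bidCDF_pos _).le, bidCDF_one (F := F) (Q := Q) ▸ hmono t.2.2⟩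
  have hNm : Monotone N := fun a b h => hmono h
  have hNc : Continuous N := by
    have hd : Differentiable ℝ (bidCDF F Q) :=
      fun t => (hQ.hasDerivAt_bidCDF hF t).differentiableAt
    exact (hd.continuous.comp continuous_subtype_val).subtype_mk _
  have hN1 : N 1 = 1 := Subtype.ext (bidCDF_one (F := F) (Q := Q))
  -- The law on quantiles with CDF `N`; since `N 0 > 0`, it has an atom at `0`.
  let μ : Measure I := volume.map fun r => sInf {t | r ≤ N t}
  have hμ : IsProbabilityMeasure μ :=
    Measure.isProbabilityMeasure_map (monotone_sInf_setOf_le N).measurable.aemeasurable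
  have hQm : Measurable Q := hQ.continuous.measurable
  refine ⟨μ.map Q, Measure.isProbabilityMeasure_map hQm.aemeasurable, fun t => ?_,
    fun f hf c hc => ?_⟩
  · have hpre : Q ⁻¹' Set.Iic (Q t) = Set.Iic t := by
      ext τ
      simp [hQ.strictMono.le_iff_le]
    rw [map_measureReal_apply hQm measurableSet_Iic, hpre, measureReal_def,
      map_sInf_setOf_le_Iic hNm hNc hN1, ENNReal.toReal_ofReal (N t).2.1]
  · rw [integral_map hQm.aemeasurable hf.aestronglyMeasurable]
    simp [hc]

/-- Bids up to `Q 1` lie in the range of `Q`. A higher bid also wins with probability one, as `Q 1`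
does, but pays more. -/
theorem mul_measureReal_Iic_le (hQ : IsODESolution F Q) (hF : Continuous (valueCDF F))
    {H : Measure I} [IsProbabilityMeasure H] (hH : ∀ t, H.real (Set.Iic (Q t)) = bidCDF F Q t)
    (y b : I) :
    ((quantile F y : ℝ) - b) * H.real (Set.Iic b)
      ≤ ((quantile F y : ℝ) - Q y) * H.real (Set.Iic (Q y)) := by
  rcases le_or_gt b (Q 1) with hb | hb
  · obtain ⟨t, rfl⟩ := hQ.exists_apply_eq hb
    rw [hH, hH]
    exact hQ.mul_bidCDF_le hF y t
  · have h1 : H.real (Set.Iic (Q 1)) = 1 := by rw [hH, Set.Icc.coe_one, bidCDF_one]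
    have hb1 : H.real (Set.Iic b) = 1 :=
      le_antisymm measureReal_le_one (h1 ▸ measureReal_mono (Set.Iic_subset_Iic.2 hb.le))
    have h := hQ.mul_bidCDF_le hF y 1
    rw [← hH, ← hH, h1] at h
    have : (Q 1 : ℝ) ≤ b := hb.le
    rw [hb1]
    linarith

theorem expectedUtility_le (hQ : IsODESolution F Q) (hF0 : valueCDF F 0 = 0)
    (hF : Continuous (valueCDF F)) {H : Measure I} [IsProbabilityMeasure H]
    (hH : ∀ t, H.real (Set.Iic (Q t)) = bidCDF F Q t) {s : I → Measure I} (hs : s ∈ strategies) :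
    expectedUtility F s H ≤ expectedUtility F (inducedStrategy F Q) H := by
  have hs' := hQ.inducedStrategy_mem hF0 hF
  have hint : ∀ {t : I → Measure I}, t ∈ strategies →
      Integrable (fun v => ∫ h, bidUtility t v h ∂H) F := fun ht =>
    (integrable_of_abs_le_one (μ := F.prod H) (measurable_bidUtility ht)
      fun p => abs_bidUtility_le ht p.1 p.2).integral_prod_left
  rw [expectedUtility_eq_integral_bidUtility H hs, expectedUtility_eq_integral_bidUtility H hs']
  refine integral_mono_ae (hint hs) (hint hs') ?_
  filter_upwards [ae_quantile_valueCDF hF0 hF] with v hv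
  have := hs.1 v
  rw [integral_bidUtility_eq H hs, integral_bidUtility_eq H hs', inducedStrategy_eq hF0 hF,
    integral_dirac]
  have hle : ∀ b : I, ((v : ℝ) - b) * H.real (Set.Iic b)
      ≤ ((v : ℝ) - Q (valueCDF F v)) * H.real (Set.Iic (Q (valueCDF F v))) := fun b => by
    have h := hQ.mul_measureReal_Iic_le hF hH (valueCDF F v) b
    rwa [hv] at h
  have hmono : Monotone fun b : I => H.real (Set.Iic b) :=
    fun _ _ h => measureReal_mono (Set.Iic_subset_Iic.2 h)
  calc _ ≤ ∫ _, ((v : ℝ) - Q (valueCDF F v)) * H.real (Set.Iic (Q (valueCDF F v))) ∂(s v) := by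
        refine integral_mono (integrable_of_abs_le_one ?_ fun b => ?_) (integrable_const _) hle
        · exact Measurable.mul (by fun_prop) hmono.measurable
        · rw [abs_mul, abs_of_nonneg (measureReal_nonneg (μ := H))]
          refine mul_le_one₀ (abs_le.2 ⟨?_, ?_⟩) measureReal_nonneg measureReal_le_one
          · linarith [v.2.1, b.2.2]
          · linarith [v.2.2, b.2.1]
    _ = _ := by simp

theorem isMinimaxOptimal (hQ : IsODESolution F Q) (hF0 : valueCDF F 0 = 0)
    (hF : Continuous (valueCDF F)) : IsMinimaxOptimal F (inducedStrategy F Q) := by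
  have hQs := hQ.inducedStrategy_mem hF0 hF
  refine ⟨hQs, fun s hs => (worstCaseRegret_le hQs fun h =>
    hQ.surplus_sub_utilityAgainst_le hF0 hF h).trans ?_⟩
  obtain ⟨H, hHp, hH, hHc⟩ := hQ.exists_measure_bidCDF hF
  have hreg : ∀ {t : I → Measure I}, t ∈ strategies →
      ∫ h, (surplus F h - utilityAgainst F t h) ∂H
        = ∫ h, surplus F h ∂H - expectedUtility F t H := fun ht => by
    rw [integral_sub (integrable_surplus H) (integrable_utilityAgainst H ht),
      expectedUtility_eq_integral_utilityAgainst H ht]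
  -- The benchmark term is the same for both strategies, so comparing average differences amounts to
  -- comparing expected utilities against `H`.
  calc surplus F (Q 1) = ∫ h, (surplus F h - utilityAgainst F (inducedStrategy F Q) h) ∂H :=
        (hHc _ ((surplus_antitone F).measurable.sub (measurable_utilityAgainst hQs)) _
          (hQ.surplus_sub_utilityAgainst_apply hF0 hF)).symm
    _ ≤ ∫ h, (surplus F h - utilityAgainst F s h) ∂H := by
        rw [hreg hQs, hreg hs]
        exact sub_le_sub_left (hQ.expectedUtility_le hF0 hF hH hs) _
    _ ≤ ∫ _, worstCaseRegret F s ∂H :=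
        integral_mono ((integrable_surplus H).sub (integrable_utilityAgainst H hs))
          (integrable_const _) (surplus_sub_utilityAgainst_le_worstCaseRegret hs)
    _ = worstCaseRegret F s := by simp

end IsODESolution

end FirstPriceAuction

namespace FirstPriceAuction

/-! ### Existence of a solution -/

theorem exists_lipschitz_inverse {W W' : ℝ → ℝ} {η : NNReal} (hη : 0 < η)
    (hW : ∀ x, HasDerivAt W (W' x) x) (hW' : ∀ x, η ≤ W' x) :
    ∃ V : ℝ → ℝ, StrictMono V ∧ LipschitzWith η⁻¹ V ∧ (∀ x, V (W x) = x) ∧ ∀ z, W (V z) = z := by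
  have hη' : (0 : ℝ) < η := hη
  have hd : Differentiable ℝ W := fun x => (hW x).differentiableAt
  have hgrow : ∀ ⦃x y⦄, x ≤ y → η * (y - x) ≤ W y - W x :=
    mul_sub_le_image_sub_of_le_deriv hd fun x => by rw [(hW x).deriv]; exact hW' x
  have hmono : StrictMono W := fun x y hxy => by
    have := hgrow hxy.le
    have := mul_pos hη' (sub_pos.2 hxy)
    linarith
  have hsurj : Function.Surjective W := by
    refine hd.continuous.surjective ?_ ?_
    · refine Filter.tendsto_atTop_mono' (f₁ := fun x => W 0 + η * x) _ ?_ ?_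
      · filter_upwards [Filter.eventually_ge_atTop 0] with x hx
        have := hgrow hx
        linarith
      · exact Filter.tendsto_atTop_add_const_left _ _ (Filter.tendsto_id.const_mul_atTop hη')
    · refine Filter.tendsto_atBot_mono' (f₁ := fun x => W 0 + η * x) _ ?_ ?_
      · filter_upwards [Filter.eventually_le_atBot 0] with x hx
        have := hgrow hx
        linarith
      · exact Filter.tendsto_atBot_add_const_left _ _ (Filter.tendsto_id.const_mul_atBot hη')
  let e := hmono.orderIsoOfSurjective W hsurj
  have hr : ∀ z, W (e.symm z) = z := e.apply_symm_apply
  refine ⟨e.symm, e.symm.strictMono, LipschitzWith.of_le_add_mul _ fun x y => ?_,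
    e.symm_apply_apply, hr⟩
  rw [NNReal.coe_inv, ← sub_le_iff_le_add', inv_mul_eq_div, le_div_iff₀' hη', Real.dist_eq]
  rcases le_total (e.symm y) (e.symm x) with h | h
  · have := hgrow h
    rw [hr, hr] at this
    exact this.trans (le_abs_self _)
  · exact (mul_nonpos_of_nonneg_of_nonpos hη'.le (sub_nonpos.2 h)).trans (abs_nonneg _)

theorem exists_hasDerivAt_comp_sub {G P : ℝ → ℝ} {K : NNReal} (hG : LipschitzWith K G)
    (hG01 : ∀ z, G z ∈ Set.Icc (0 : ℝ) 1) (hP : Continuous P) :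
    ∃ u u' : ℝ → ℝ, u 0 = 0 ∧ Continuous u' ∧ (∀ t, u' t ∈ Set.Icc (0 : ℝ) 1) ∧
      (∀ t, HasDerivAt u (u' t) t) ∧ ∀ t ∈ Set.Icc (0 : ℝ) 1, u' t = G (P t - u t) := by
  -- Since `0 ≤ G ≤ 1`, the solution stays within distance `1` of `0` throughout `[0,1]`, so one
  -- application covers the whole interval.
  have hPL : IsPicardLindelof (fun t x => G (P t - x))
      (⟨0, Set.left_mem_Icc.2 zero_le_one⟩ : Set.Icc (0 : ℝ) 1) 0 1 0 1 K := by
    refine ⟨fun t _ => ?_, fun x _ => ?_, fun t _ x _ => ?_, by norm_num⟩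
    · refine (LipschitzWith.of_dist_le_mul fun x y => ?_).lipschitzOnWith
      refine (hG.dist_le_mul _ _).trans_eq ?_
      rw [dist_sub_left]
    · exact (hG.continuous.comp (hP.sub continuous_const)).continuousOn
    · rw [Real.norm_of_nonneg (hG01 _).1]
      exact (hG01 _).2
  obtain ⟨α, hα0, hα⟩ := hPL.exists_eq_forall_mem_Icc_hasDerivWithinAt₀
  have hαc : ContinuousOn α (Set.Icc 0 1) := fun t ht => (hα t ht).continuousWithinAt
  let u' : ℝ → ℝ := fun t => G (P t - Set.IccExtend (zero_le_one' ℝ) (Set.domRestrict _ α) t)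
  have hu'c : Continuous u' :=
    hG.continuous.comp (hP.sub (continuousOn_iff_continuous_domRestrict.1 hαc).Icc_extend')
  have hu' : ∀ t ∈ Set.Icc (0 : ℝ) 1, u' t = G (P t - α t) := fun t ht => by
    simp only [u', Set.IccExtend_of_mem _ _ ht, Set.domRestrict_apply]
  -- Replacing `α` by a primitive of the extended velocity gives two-sided derivatives everywhere,
  -- including at the endpoints.
  refine ⟨fun t => ∫ τ in (0 : ℝ)..t, u' τ, u', intervalIntegral.integral_same, hu'c,
    fun t => hG01 _, fun t => hu'c.integral_hasStrictDerivAt 0 t |>.hasDerivAt, fun t ht => ?_⟩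
  rw [hu' t ht]
  have h := intervalIntegral.integral_eq_sub_of_hasDerivAt_of_le ht.1
    (hαc.mono (Set.Icc_subset_Icc_right ht.2)) (f' := u') (fun x hx => by
      have hx' : x ∈ Set.Icc (0 : ℝ) 1 := ⟨hx.1.le, hx.2.le.trans ht.2⟩
      rw [hu' x hx']
      exact (hα x hx').hasDerivAt (Icc_mem_nhds hx.1 (hx.2.trans_le ht.2)))
    (hu'c.intervalIntegrable _ _)
  have hα0' : α 0 = 0 := hα0
  change _ = G (P t - ∫ τ in (0 : ℝ)..t, u' τ)
  rw [h, hα0', sub_zero]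

/-! ### The integrated quantile function -/

section Existence

variable (F : Measure I) [IsProbabilityMeasure F]

/-- Integral of the quantile function. -/
noncomputable def quantileIntegral (t : ℝ) : ℝ := ∫ τ in (0 : ℝ)..t, extend (quantile F) τ

theorem intervalIntegrable_quantile (a b : ℝ) :
    IntervalIntegrable (extend (quantile F)) volume a b :=
  (extend_monotone (quantile_monotone F)).intervalIntegrable

theorem quantileIntegral_sub (a b : ℝ) :
    quantileIntegral F b - quantileIntegral F a = ∫ τ in a..b, extend (quantile F) τ :=
  intervalIntegral.integral_interval_sub_left (intervalIntegrable_quantile F _ _)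
    (intervalIntegrable_quantile F _ _)

theorem quantileIntegral_monotone : Monotone (quantileIntegral F) := fun a b h => by
  rw [← sub_nonneg, quantileIntegral_sub]
  exact intervalIntegral.integral_nonneg h fun τ _ => (extend_mem _ τ).1

theorem lipschitzWith_quantileIntegral : LipschitzWith 1 (quantileIntegral F) :=
  LipschitzWith.of_dist_le_mul fun x y => by
    rw [Real.dist_eq, quantileIntegral_sub]
    refine intervalIntegral.norm_integral_le_of_norm_le_const (E := ℝ) fun t _ => ?_
    rw [Real.norm_of_nonneg (extend_mem _ t).1]
    exact (extend_mem _ t).2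

theorem quantileIntegral_zero : quantileIntegral F 0 = 0 := intervalIntegral.integral_same

theorem quantileIntegral_le {t : ℝ} (ht : 0 ≤ t) : quantileIntegral F t ≤ t := by
  have h := (lipschitzWith_quantileIntegral F).dist_le_mul t 0
  rw [Real.dist_eq, Real.dist_eq, quantileIntegral_zero, sub_zero, sub_zero, abs_of_nonneg ht,
    NNReal.coe_one, one_mul] at h
  exact (le_abs_self _).trans h

variable {F}

theorem extend_quantile_pos (hF0 : valueCDF F 0 = 0) (hF : Continuous (valueCDF F)) {t : ℝ}
    (ht : 0 < t) : 0 < extend (quantile F) t := by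
  have h := quantile_strictMono hF0 hF (a := 0) (b := Set.projIcc 0 1 zero_le_one t)
    (Subtype.coe_lt_coe.1 (lt_max_of_lt_right (lt_min one_pos ht)))
  rw [quantile_zero hF] at h
  exact h

theorem quantileIntegral_pos (hF0 : valueCDF F 0 = 0) (hF : Continuous (valueCDF F)) {t : ℝ}
    (ht : 0 < t) : 0 < quantileIntegral F t :=
  intervalIntegral.intervalIntegral_pos_of_pos_on (intervalIntegrable_quantile F _ _)
    (fun _ hx => extend_quantile_pos hF0 hF hx.1) ht

/-- With `q = F⁻(y)`, the right-hand side is the expectation of `min v q`, that is `∫_0^1 min(F⁻,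
q)`. Restricting to `[0, y]`, where `F⁻ ≤ q`, leaves the left-hand side. -/
theorem quantileIntegral_le_integral_tail (hF : Continuous (valueCDF F)) (y : I) :
    quantileIntegral F y ≤ ∫ x in (0 : ℝ)..quantile F y, tail F x := by
  have h := surplus_sub_surplus F 0 (quantile F y)
  rw [Set.Icc.coe_zero] at h
  rw [← h, surplus, surplus, ← integral_sub (integrable_max_sub _) (integrable_max_sub _),
    integral_eq_integral_quantile hF (by fun_prop)]
  have h1 : ∀ t : I, max ((quantile F t : ℝ) - (0 : I)) 0
      - max ((quantile F t : ℝ) - quantile F y) 0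
      = min (extend (quantile F) t) (quantile F y) := fun t => by
    rw [extend_coe, Set.Icc.coe_zero, sub_zero, max_eq_left (quantile F t).2.1]
    rcases le_total (quantile F t : ℝ) (quantile F y) with h | h
    · rw [max_eq_right (sub_nonpos.2 h), min_eq_left h, sub_zero]
    · rw [max_eq_left (sub_nonneg.2 h), min_eq_right h, sub_sub_cancel]
  simp only [h1]
  rw [integral_unitInterval_eq fun t => min (extend (quantile F) t) (quantile F y)]
  have hm : Monotone fun t => min (extend (quantile F) t) (quantile F y) :=
    (extend_monotone (quantile_monotone F)).min monotone_const
  rw [← intervalIntegral.integral_add_adjacent_intervals (b := (y : ℝ))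
    hm.intervalIntegrable hm.intervalIntegrable]
  have h2 : quantileIntegral F y
      = ∫ t in (0 : ℝ)..y, min (extend (quantile F) t) (quantile F y) := by
    refine intervalIntegral.integral_congr fun t ht => ?_
    rw [Set.uIcc_of_le y.2.1] at ht
    have h3 := extend_monotone (quantile_monotone F) ht.2
    rw [extend_coe] at h3
    exact (min_eq_left h3).symm
  rw [h2]
  exact le_add_of_nonneg_right (intervalIntegral.integral_nonneg y.2.2 fun t _ =>
    le_min (extend_mem _ t).1 (quantile F y).2.1)

end Existence

end FirstPriceAuction

namespace FirstPriceAuction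

section Existence

variable {F : Measure I} [IsProbabilityMeasure F]

/-- Solution of the initial value problem `V⁻¹(Q)' = F⁻ - Q`, `Q 0 = 0`, where `W = V⁻¹` bounds the
integral of the tail from above. Here `Q = u'`, and `W ∘ Q` is the integral of `F⁻` minus `u`. -/
theorem exists_regularized_solution (hF0 : valueCDF F 0 = 0) (hF : Continuous (valueCDF F))
    {W V : ℝ → ℝ} {K : NNReal} (hV : StrictMono V) (hVL : LipschitzWith K V)
    (hVW : ∀ x, V (W x) = x) (hWV : ∀ z, W (V z) = z) (hW0 : W 0 = 0)
    (hWle : ∀ x, 0 ≤ x → W x ≤ x)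
    (hWtail : ∀ x : I, ∫ t in (0 : ℝ)..x, tail F t ≤ W x) :
    ∃ u u' : ℝ → ℝ, Continuous u' ∧ (∀ t, u' t ∈ Set.Icc (0 : ℝ) 1) ∧
      (∀ t, HasDerivAt u (u' t) t) ∧ u 0 = 0 ∧
      ∀ t ∈ Set.Icc (0 : ℝ) 1, u' t = V (quantileIntegral F t - u t) ∧
        (0 < t → u' t < extend (quantile F) t) ∧
        ∫ τ in (0 : ℝ)..t, quantileIntegral F τ ≤ u t * (1 + t) := by
  have hV0 : V 0 = 0 := by rw [← hW0, hVW, hW0]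
  -- The velocity is clamped to `[0,1]` to get a globally bounded field; `hueq` shows that the clamp
  -- is never active.
  have hG : LipschitzWith K fun z => max 0 (min 1 (V z)) :=
    (hVL.const_min 1).const_max 0
  obtain ⟨u, u', hu0, hu'c, hu'01, hu, hu'⟩ := exists_hasDerivAt_comp_sub hG
    (fun z => ⟨le_max_left _ _, max_le zero_le_one (min_le_left _ _)⟩)
    (lipschitzWith_quantileIntegral F).continuous
  have hsub : ∀ a b, u b - u a = ∫ τ in a..b, u' τ := fun a b =>
    (intervalIntegral.integral_eq_sub_of_hasDerivAt (fun x _ => hu x)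
      (hu'c.intervalIntegrable _ _)).symm
  have huc : Continuous u := continuous_iff_continuousAt.2 fun t => (hu t).continuousAt
  have humono : Monotone u := monotone_of_deriv_nonneg (fun t => (hu t).differentiableAt)
    fun t => by rw [(hu t).deriv]; exact (hu'01 t).1
  have hPc := (lipschitzWith_quantileIntegral F).continuous
  set z : ℝ → ℝ := fun t => quantileIntegral F t - u t with hz
  have hzc : Continuous z := hPc.sub huc
  have hz0 : z 0 = 0 := by simp [hz, hu0, quantileIntegral_zero]
  -- After the last time at which `z ≥ 0`, the clamp gives `u' = 0`, while `P` is nondecreasing;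
  -- hence `z` cannot become negative.
  have hznonneg : ∀ y ∈ Set.Icc (0 : ℝ) 1, 0 ≤ z y := by
    intro y hy
    by_contra! hneg
    have hScl : IsCompact (Set.Icc 0 y ∩ {t | 0 ≤ z t}) :=
      isCompact_Icc.inter_right (isClosed_le continuous_const hzc)
    obtain ⟨t₀, ⟨ht₀, hzt₀⟩, hmax⟩ := hScl.exists_isGreatest
      ⟨0, Set.left_mem_Icc.2 hy.1, hz0.ge⟩
    have hint : ∫ τ in t₀..y, u' τ = 0 := by
      refine intervalIntegral.integral_zero_ae (.of_forall fun τ hτ => ?_)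
      rw [Set.uIoc_of_le ht₀.2] at hτ
      have hτ0 : 0 ≤ τ := ht₀.1.trans hτ.1.le
      have hzτ : z τ < 0 := by
        by_contra! hc
        exact hτ.1.not_ge (hmax ⟨⟨hτ0, hτ.2⟩, hc⟩)
      rw [hu' τ ⟨hτ0, hτ.2.trans hy.2⟩]
      exact max_eq_left ((min_le_right _ _).trans (hV0 ▸ (hV hzτ).le))
    have h1 := quantileIntegral_monotone F ht₀.2
    have h2 := hsub t₀ y
    have h3 : 0 ≤ z t₀ := hzt₀
    simp only [hz] at hneg h3
    linarith
  have hVnonneg : ∀ y ∈ Set.Icc (0 : ℝ) 1, 0 ≤ V (z y) := fun y hy =>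
    hV0 ▸ hV.monotone (hznonneg y hy)
  -- `W x ≤ x` for `x ≥ 0` gives `z = W (V z) ≤ V z`.
  have hu_le : ∀ y ∈ Set.Icc (0 : ℝ) 1, z y ≤ u' y := fun y hy => by
    rw [hu' y hy]
    have h1 : z y ≤ V (z y) := by
      have h := hWle _ (hVnonneg y hy)
      rwa [hWV] at h
    have h2 : z y ≤ 1 := by
      have h3 := quantileIntegral_le F hy.1
      have h4 := humono hy.1
      have h5 := hy.2
      simp only [hz]
      linarith
    exact le_max_of_le_right (le_min h2 h1)
  -- On `[0, y]`, `u' ≥ z ≥ P - u y` by monotonicity of `u`; this is then integrated. The bound does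
  -- not depend on the regularization, which is what allows `η` to be fixed in advance.
  have hugrow : ∀ y ∈ Set.Icc (0 : ℝ) 1,
      ∫ τ in (0 : ℝ)..y, quantileIntegral F τ ≤ u y * (1 + y) := fun y hy => by
    have h1 : ∫ τ in (0 : ℝ)..y, (quantileIntegral F τ - u y) ≤ ∫ τ in (0 : ℝ)..y, u' τ := by
      refine intervalIntegral.integral_mono_on hy.1
        ((hPc.sub continuous_const).intervalIntegrable _ _) (hu'c.intervalIntegrable _ _)
        fun τ hτ => ?_
      have h2 := hu_le τ ⟨hτ.1, hτ.2.trans hy.2⟩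
      have h3 := humono hτ.2
      simp only [hz] at h2
      linarith
    rw [← hsub, intervalIntegral.integral_sub (hPc.intervalIntegrable _ _)
      (continuous_const.intervalIntegrable _ _), intervalIntegral.integral_const, smul_eq_mul] at h1
    linarith
  -- `W (F⁻(y)) ≥ P y`, and `P y > z y` because `u y > 0`; then `V` is applied.
  have hVlt : ∀ y ∈ Set.Icc (0 : ℝ) 1, 0 < y → V (z y) < extend (quantile F) y := fun y hy hy0 => by
    rw [extend_of_mem _ hy, ← hVW (quantile F ⟨y, hy⟩)]
    refine hV (lt_of_lt_of_le ?_ ((quantileIntegral_le_integral_tail hF ⟨y, hy⟩).trans (hWtail _)))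
    have h1 : 0 < ∫ τ in (0 : ℝ)..y, quantileIntegral F τ :=
      intervalIntegral.intervalIntegral_pos_of_pos_on (hPc.intervalIntegrable _ _)
        (fun _ hx => quantileIntegral_pos hF0 hF hx.1) hy0
    have h2 : 0 < u y := pos_of_mul_pos_left (h1.trans_le (hugrow y hy)) (by linarith)
    simp only [hz]
    linarith
  have hueq : ∀ y ∈ Set.Icc (0 : ℝ) 1, u' y = V (z y) := fun y hy => by
    rw [hu' y hy]
    have h1 : V (z y) ≤ 1 := by
      rcases hy.1.eq_or_lt with h0 | h0
      · rw [← h0, hz0, hV0]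
        exact zero_le_one
      · exact (hVlt y hy h0).le.trans (extend_mem _ y).2
    rw [min_eq_right h1, max_eq_right (hVnonneg y hy)]
  exact ⟨u, u', hu'c, hu'01, hu, hu0, fun t ht => ⟨hueq t ht,
    fun h0 => (hueq t ht).trans_lt (hVlt t ht h0), hugrow t ht⟩⟩

theorem exists_isODESolution (hF0 : valueCDF F 0 = 0) (hF : Continuous (valueCDF F)) :
    ∃ Q : I → I, IsODESolution F Q := by
  have hPL := lipschitzWith_quantileIntegral F
  have hPc := hPL.continuous
  have hA : 0 < ∫ τ in (0 : ℝ)..1, quantileIntegral F τ :=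
    intervalIntegral.intervalIntegral_pos_of_pos_on (hPc.intervalIntegrable _ _)
      (fun _ hx => quantileIntegral_pos hF0 hF hx.1) one_pos
  have hA1 : ∫ τ in (0 : ℝ)..1, quantileIntegral F τ ≤ 1 := by
    have h := intervalIntegral.integral_mono_on (μ := volume) zero_le_one (hPc.intervalIntegrable 0 1)
      (continuous_const.intervalIntegrable 0 1) (g := fun _ => (1 : ℝ))
      fun τ hτ => (quantileIntegral_le F hτ.1).trans hτ.2
    simpa using h
  -- With `A = ∫_0^1 P`, the growth bound gives `u 1 ≥ A / 2`. The choice `A / 4` lies strictly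
  -- below this, which yields the contradiction in `htail`.
  obtain ⟨η, hη⟩ : ∃ η : NNReal, (η : ℝ) = (∫ τ in (0 : ℝ)..1, quantileIntegral F τ) / 4 :=
    ⟨⟨_, by positivity⟩, rfl⟩
  have hηpos : 0 < η := by
    rw [← NNReal.coe_pos, hη]
    positivity
  have hηpos' : (0 : ℝ) < η := hηpos
  let φ : ℝ → ℝ := fun x => max (tail F x) η
  have hφc : Continuous φ := (tail_continuous hF).max continuous_const
  let W : ℝ → ℝ := fun x => ∫ t in (0 : ℝ)..x, φ t
  have hW : ∀ x, HasDerivAt W (φ x) x := fun x => (hφc.integral_hasStrictDerivAt 0 x).hasDerivAt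
  have hWsub : ∀ a b, W b - W a = ∫ t in a..b, φ t := fun a b =>
    intervalIntegral.integral_interval_sub_left (hφc.intervalIntegrable _ _)
      (hφc.intervalIntegrable _ _)
  have hφη : ∀ x, η ≤ φ x := fun x => le_max_right _ _
  have hφ1 : ∀ x, φ x ≤ 1 := fun x => max_le (tail_le_one F x) (by rw [hη]; linarith)
  obtain ⟨V, hV, hVL, hVW, hWV⟩ := exists_lipschitz_inverse hηpos hW hφη
  have hW0 : W 0 = 0 := intervalIntegral.integral_same
  have hWle : ∀ x, 0 ≤ x → W x ≤ x := fun x hx => by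
    have h := intervalIntegral.integral_mono_on (μ := volume) hx (hφc.intervalIntegrable 0 x)
      (continuous_const.intervalIntegrable 0 x) (g := fun _ => (1 : ℝ)) fun τ _ => hφ1 τ
    rwa [intervalIntegral.integral_const, sub_zero, smul_eq_mul, mul_one] at h
  have hWtail : ∀ x : I, ∫ t in (0 : ℝ)..x, tail F t ≤ W x := fun x =>
    intervalIntegral.integral_mono_on x.2.1 (intervalIntegrable_tail F _ _)
      (hφc.intervalIntegrable _ _) fun τ _ => le_max_left _ _
  obtain ⟨u, u', hu'c, hu'01, hu, hu0, hsol⟩ :=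
    exists_regularized_solution hF0 hF hV hVL hVW hWV hW0 hWle hWtail
  have hV0 : V 0 = 0 := by rw [← hW0, hVW, hW0]
  have husub : ∀ a b, u b - u a = ∫ τ in a..b, u' τ := fun a b =>
    (intervalIntegral.integral_eq_sub_of_hasDerivAt (fun x _ => hu x)
      (hu'c.intervalIntegrable _ _)).symm
  have hzsub : ∀ a b, quantileIntegral F b - u b - (quantileIntegral F a - u a)
      = ∫ τ in a..b, (extend (quantile F) τ - u' τ) := fun a b => by
    rw [intervalIntegral.integral_sub (intervalIntegrable_quantile F a b)
      (hu'c.intervalIntegrable a b), ← quantileIntegral_sub, ← husub]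
    ring
  have hzmono : ∀ a b : ℝ, 0 ≤ a → b ≤ 1 → a < b →
      quantileIntegral F a - u a < quantileIntegral F b - u b := fun a b ha hb hab => by
    rw [← sub_pos, hzsub]
    refine intervalIntegral.intervalIntegral_pos_of_pos_on
      ((intervalIntegrable_quantile F a b).sub (hu'c.intervalIntegrable a b)) (fun x hx => ?_) hab
    have hx0 := ha.trans_lt hx.1
    exact sub_pos.2 ((hsol x ⟨hx0.le, hx.2.le.trans hb⟩).2.1 hx0)
  -- If the tail were below `η` at `u' t`, it would stay so up to `1`, whence `W 1 - z t = (1 - u'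
  -- t) η ≤ η`. But `W 1 ≥ P 1` and `z t ≤ z 1 = P 1 - u 1`, so `u 1 ≤ η`, which is too small.
  have htail : ∀ t ∈ Set.Icc (0 : ℝ) 1, φ (u' t) = tail F (u' t) := fun t ht => by
    refine max_eq_left ?_
    by_contra! hlt
    obtain ⟨heq, -, -⟩ := hsol t ht
    have h1 : ∫ x in u' t..1, φ x = (1 - u' t) * η := by
      rw [← smul_eq_mul, ← intervalIntegral.integral_const]
      refine intervalIntegral.integral_congr fun x hx => ?_
      rw [Set.uIcc_of_le (hu'01 t).2] at hx
      exact max_eq_right ((tail_antitone F hx.1).trans hlt.le)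
    rw [← hWsub, heq, hWV, ← heq] at h1
    have h2 : quantileIntegral F 1 ≤ W 1 := by
      have h3 := quantileIntegral_le_integral_tail hF 1
      refine (h3.trans (hWtail _)).trans ?_
      rw [← sub_nonneg, hWsub]
      exact intervalIntegral.integral_nonneg (quantile F 1).2.2 fun x _ => hηpos'.le.trans (hφη x)
    have h4 : quantileIntegral F t - u t ≤ quantileIntegral F 1 - u 1 := by
      rcases ht.2.eq_or_lt with h | h
      · rw [h]
      · exact (hzmono t 1 ht.1 le_rfl h).le
    have h5 := (hsol 1 (Set.right_mem_Icc.2 zero_le_one)).2.2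
    have h6 : 0 ≤ u' t * η := mul_nonneg (hu'01 t).1 hηpos'.le
    linarith
  have hext : ∀ t ∈ Set.Icc (0 : ℝ) 1, extend (fun y : I => ⟨u' y, hu'01 y⟩) t
      = V (quantileIntegral F t - u t) := fun t ht => by
    rw [extend_of_mem _ ht]
    exact (hsol t ht).1
  have huL : LipschitzWith 1 u :=
    lipschitzWith_of_nnnorm_deriv_le (fun x => (hu x).differentiableAt) fun x => by
      rw [(hu x).deriv, ← NNReal.coe_le_coe, coe_nnnorm, NNReal.coe_one,
        Real.norm_of_nonneg (hu'01 x).1]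
      exact (hu'01 x).2
  have hQmono : StrictMono fun y : I => (⟨u' y, hu'01 y⟩ : I) := fun a b hab => by
    rw [← Subtype.coe_lt_coe]
    change u' a < u' b
    rw [(hsol a a.2).1, (hsol b b.2).1]
    exact hV (hzmono a b a.2.1 b.2.2 hab)
  have hQ0 : (⟨u' (0 : I), hu'01 _⟩ : I) = 0 := by
    ext
    change u' (0 : I) = 0
    rw [(hsol _ (0 : I).2).1, Set.Icc.coe_zero, hu0, quantileIntegral_zero, sub_zero, hV0]
  refine ⟨fun y => ⟨u' y, hu'01 y⟩, ⟨⟨hQmono, ?_⟩, hQ0, ?_, fun y hy => ?_, fun y hy => ?_⟩⟩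
  · refine LipschitzOnWith.absolutelyContinuousOnInterval (K := η⁻¹ * (1 + 1)) ?_
    rw [Set.uIcc_of_le zero_le_one]
    intro a ha b hb
    change edist (extend _ a) (extend _ b) ≤ _
    rw [hext a ha, hext b hb]
    exact hVL.comp (hPL.sub huL) a b
  -- `P' = F⁻` holds at continuity points of the monotone function `F⁻`, which are all but countably
  -- many. Only there is the ODE obtained, by differentiating `Q = V (P - u)`.
  · have hcont : ∀ᵐ t : ℝ, ContinuousAt (extend (quantile F)) t := by
      filter_upwards [(extend_monotone (quantile_monotone F)).countable_not_continuousAt.ae_notMem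
        volume] with t ht
      exact not_not.1 ht
    have hcont' : ∀ᵐ y : I, ContinuousAt (extend (quantile F)) y :=
      (ae_unitInterval_iff (p := fun t => ContinuousAt (extend (quantile F)) t)).2
        (hcont.mono fun t ht _ => ht)
    filter_upwards [hcont'] with y hy
    have hP : HasDerivAt (quantileIntegral F) (extend (quantile F) y) y :=
      intervalIntegral.integral_hasDerivAt_right (intervalIntegrable_quantile F _ _)
        (extend_monotone
          (quantile_monotone F)).measurable.stronglyMeasurable.stronglyMeasurableAtFilter
        hy
    have hVd : HasDerivAt V (φ (u' y))⁻¹ (quantileIntegral F y - u y) := by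
      refine HasDerivAt.of_local_left_inverse hVL.continuous.continuousAt ?_
        (hηpos'.trans_le (hφη _)).ne' (.of_forall hWV)
      rw [← (hsol y y.2).1]
      exact hW _
    have hd := (hVd.comp (y : ℝ) (hP.sub (hu y))).hasDerivWithinAt (s := Set.Icc 0 1)
    refine (hd.congr hext (hext y y.2)).congr_deriv ?_
    rw [htail y y.2, extend_coe, inv_mul_eq_div, ← tail_coe]
  · rw [← hQ0]
    exact hQmono hy
  · rw [← Subtype.coe_lt_coe, ← extend_coe (quantile F) y]
    exact (hsol y y.2).2.1 hy

end Existence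

end FirstPriceAuction

theorem mainTheorem6 (F : MeasureTheory.Measure unitInterval)
    [MeasureTheory.IsProbabilityMeasure F]
    (hF0 : FirstPriceAuction.valueCDF F 0 = 0)
    (hF : Continuous (FirstPriceAuction.valueCDF F)) :
    (∃ Q : unitInterval → unitInterval, FirstPriceAuction.IsODESolution F Q) ∧
    ∀ Q : unitInterval → unitInterval, FirstPriceAuction.IsODESolution F Q →
      FirstPriceAuction.IsMinimaxOptimal F (FirstPriceAuction.inducedStrategy F Q) ∧
      FirstPriceAuction.IsDeterministic (FirstPriceAuction.inducedStrategy F Q) :=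
  ⟨FirstPriceAuction.exists_isODESolution hF0 hF, fun Q hQ =>
    ⟨hQ.isMinimaxOptimal hF0 hF, FirstPriceAuction.isDeterministic_inducedStrategy hF0 hF Q⟩⟩
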